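/- All graphs are finite and may have loops and multiple edges; a loop contributes $2$ to the degree of its vertex. A signed graph is a graph together with a signature assigning $+1$ or $-1$ to each edge; an edge is negative if it has value $-1$. A circuit is a closed trail with at least one edge whose vertices are distinct except that the first one equals the last one (so a loop is a circuit); it is unbalanced if it contains an odd number of negative edges. A graph is eulerian if it is connected and all its vertices have even degree. A graph is $k$-edge-connected if it is connected and remains connected after the removal of any fewer than $k$ edges; by convention, a graph with a single vertex and $d$ loops is $k$-edge-connected only if $k\le 2d$. **Theorem.** Let $G$ be a $6$-edge-connected $6$-regular signed graph with an odd number of negative edges that contains two edge-disjoint unbalanced circuits. Then $G$ has a rooted $3$-odd decomposition; that is, there are subgraphs $G_1,G_2,G_3$ of $G$ whose edge sets partition $E(G)$, such that each $G_i$ is eulerian and has an odd number of negative edges, and there is a vertex $v$ of $G$ contained in all three of $G_1,G_2,G_3$. -/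

import Mathlib

open scoped Graph

namespace Graph

variable {α β : Type*}

/-- A finite multigraph (loops and parallel edges allowed). -/
structure IsFinite (G : Graph α β) : Prop where
  vertexSet_finite : V(G).Finite
  edgeSet_finite : E(G).Finite

/-- The degree of a vertex of a finite graph: the number of incident edges, each loop being
counted twice. -/
noncomputable def deg (G : Graph α β) (v : α) : ℕ :=
  (G.incidenceSet v).ncard + (G.loopSet v).ncard

/-- Every vertex has degree `d`. -/
def IsRegular (G : Graph α β) (d : ℕ) : Prop :=
  ∀ v ∈ V(G), G.deg v = d

/-- A connected graph is non-empty, and one can go from any vertex to any other along edges. -/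
def IsConnected (G : Graph α β) : Prop :=
  V(G).Nonempty ∧ ∀ u ∈ V(G), ∀ v ∈ V(G), Relation.ReflTransGen G.Adj u v

/-- `G` is `k`-edge-connected: the removal of fewer than `k` edges leaves `G` connected. By
convention the edge-connectivity of a graph with a single vertex and `d` loops is `2 * d`. -/
def IsEdgeConnected (G : Graph α β) (k : ℕ) : Prop :=
  G.IsConnected ∧
  (V(G).Subsingleton → k ≤ 2 * E(G).ncard) ∧
  ∀ F : Set β, F ⊆ E(G) → F.encard < k → (G.deleteEdges F).IsConnected

/-- An eulerian graph is connected and all its vertices have even degree. -/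
def IsEulerian (G : Graph α β) : Prop :=
  G.IsConnected ∧ ∀ v ∈ V(G), Even (G.deg v)

/-- A trail `v₀ e₁ v₁ e₂ … eₖ vₖ`: the edge `eᵢ` joins `vᵢ₋₁` to `vᵢ`, and all edge terms are
distinct. -/
structure Trail (G : Graph α β) where
  /-- The number of edge terms. -/
  length : ℕ
  /-- The vertex terms. -/
  vert : Fin (length + 1) → α
  /-- The edge terms. -/
  edge : Fin length → β
  vert_mem : ∀ i, vert i ∈ V(G)
  isLink : ∀ i : Fin length, G.IsLink (edge i) (vert i.castSucc) (vert i.succ)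
  edge_injective : Function.Injective edge

namespace Trail

variable {G : Graph α β}

/-- The set of edges of a trail. -/
def edges (T : G.Trail) : Set β := Set.range T.edge

/-- A trail is closed if it ends at the vertex where it starts. -/
def IsClosed (T : G.Trail) : Prop := T.vert 0 = T.vert (Fin.last T.length)

/-- A circuit is a closed trail with at least one edge, all of whose vertex terms are distinct
except that the first one equals the last one. A loop is a circuit of length 1, and a pair of
parallel edges gives a circuit of length 2. -/
def IsCircuit (T : G.Trail) : Prop :=
  T.IsClosed ∧ 0 < T.length ∧ Function.Injective (fun i : Fin T.length => T.vert i.castSucc)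

/-- A circuit of a signed graph is unbalanced if it contains an odd number of negative edges.
The signature `σ` assigns `1` or `-1` to each edge. -/
def IsUnbalancedCircuit (σ : β → ℤˣ) (T : G.Trail) : Prop :=
  T.IsCircuit ∧ Odd {e ∈ T.edges | σ e = -1}.ncard

end Trail

/-- The set of negative edges of the graph `G` with signature `σ`; only the values of `σ` on the
edge set of `G` matter. -/
def negEdges (G : Graph α β) (σ : β → ℤˣ) : Set β := {e ∈ E(G) | σ e = -1}

/-- `G₁, …, Gₖ` is a `k`-odd decomposition of the signed graph `(G, σ)`: the `Gᵢ` are subgraphs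
whose edge sets partition the edge set of `G`, and each `Gᵢ` is eulerian and has an odd number of
negative edges. (In particular the `Gᵢ` have non-empty edge sets and are distinct.) -/
structure IsOddDecomposition (G : Graph α β) (σ : β → ℤˣ) {k : ℕ}
    (D : Fin k → Graph α β) : Prop where
  le : ∀ i, D i ≤ G
  disjoint : Pairwise fun i j => Disjoint E(D i) E(D j)
  iUnion_eq : ⋃ i, E(D i) = E(G)
  eulerian : ∀ i, (D i).IsEulerian
  odd : ∀ i, Odd ((D i).negEdges σ).ncard

/-- The signed graph `(G, σ)` has a rooted `k`-odd decomposition: a `k`-odd decomposition all of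
whose constituents contain a common vertex, the root. -/
def HasRootedOddDecomposition (G : Graph α β) (σ : β → ℤˣ) (k : ℕ) : Prop :=
  ∃ D : Fin k → Graph α β, G.IsOddDecomposition σ D ∧ ∃ v ∈ V(G), ∀ i, v ∈ V(D i)

end Graph

open scoped Graph

namespace SignedMultigraph

/-! The proof is by induction on the number of vertices, using Lovász splitting
(`IsPartial.exists_step`): in a 6-edge-connected 6-regular multigraph the edges at a vertex can be
paired off and replaced by single edges, signs adding, so that the smaller multigraph is again
6-regular and 6-edge-connected. A rooted decomposition of the smaller multigraph lifts back
(`HasRootedPartition.unsplit`).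

The hypothesis carried by the induction is not the pair of disjoint circuits but a weaker
consequence: no switching leaves exactly one negative edge. If splitting off `v` keeps this
property, induction applies. Otherwise some switching leaves one negative edge after the splitting;
the same switching of the original multigraph has at most one negative edge away from `v`, since
edges off `v` survive. Switching at `v` if needed then gives exactly three negative edges
(`hasRootedPartition_of_negCountOff_le_one`).

If all three are at `v`, splitting off all but one of the other vertices leaves six parallel edges,
three of them negative, that is, three unbalanced digons (`hasRootedPartition_of_star`). If one is
an edge `xy` away from `v`, splitting down to `v`, `x`, `y` and then merging `xy` with a positive
edge from `v` returns to the previous case (`hasRootedPartition_of_cons_star`). -/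

/-- An edge of a signed multigraph, given by its unordered pair of ends and its sign: the
sign is `1` if the edge is negative and `0` otherwise. A signed multigraph is a multiset of
signed edges. -/
abbrev SignedEdge (α : Type*) := Sym2 α × ZMod 2

/-! ### Signs and parity -/

variable {α : Type*}

/-- The number of negative edges modulo 2. -/
def parity (M : Multiset (SignedEdge α)) : ZMod 2 := (M.map Prod.snd).sum

/-- The number of negative edges. -/
def negCount (M : Multiset (SignedEdge α)) : ℕ := M.countP fun e => e.2 = 1

lemma zmod_two_cases (a : ZMod 2) : a = 0 ∨ a = 1 := by
  revert a; decide

@[simp] lemma parity_cons (e : SignedEdge α) (M : Multiset (SignedEdge α)) :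
    parity (e ::ₘ M) = e.2 + parity M := by simp [parity]

lemma parity_eq_negCount (M : Multiset (SignedEdge α)) : parity M = negCount M := by
  induction M using Multiset.induction_on with
  | empty => simp [parity, negCount]
  | cons e M ih =>
    obtain ⟨e, a⟩ := e
    rw [parity_cons, ih, negCount, negCount, Multiset.countP_cons]
    rcases zmod_two_cases a with rfl | rfl <;> simp [add_comm]

lemma sum_map_add_le {ι : Type*} {f g h : ι → ℕ} {M : Multiset ι}
    (H : ∀ e ∈ M, f e + g e ≤ h e) : (M.map f).sum + (M.map g).sum ≤ (M.map h).sum := by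
  rw [← Multiset.sum_map_add]
  exact Multiset.sum_map_le_sum_map _ _ H

lemma exists_cons_of_mem {z : α} {M : Multiset (SignedEdge α)} (hl : ∀ e ∈ M, e.1 ≠ s(z, z))
    (h : ∃ e ∈ M, z ∈ e.1) : ∃ s a M₁, s ≠ z ∧ M = (s(s, z), a) ::ₘ M₁ := by
  obtain ⟨⟨e, a⟩, he, hz⟩ := h
  obtain ⟨s, rfl⟩ := Sym2.mem_iff_exists.1 hz
  obtain ⟨M₁, rfl⟩ := Multiset.exists_cons_of_mem he
  have := hl _ he
  refine ⟨s, a, M₁, ?_, by rw [Sym2.eq_swap]⟩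
  rintro rfl
  exact this rfl

lemma ne_singleton_of_two_le_card {W : Finset α} (h : 2 ≤ W.card) (v : α) : W ≠ {v} := by
  rintro rfl
  simp at h

/-- Serves the base cases with one or two vertices, where all edges are parallel and only signs
matter. -/
lemma eq_replicate_add {e : Sym2 α} {M : Multiset (SignedEdge α)} (h : ∀ f ∈ M, f.1 = e) :
    M = Multiset.replicate (negCount M) (e, 1) +
      Multiset.replicate (M.card - negCount M) (e, 0) := by
  induction M using Multiset.induction_on with
  | empty => simp [negCount]
  | cons f M ih =>
    simp only [Multiset.mem_cons, forall_eq_or_imp] at h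
    obtain ⟨f, a⟩ := f
    obtain ⟨rfl, h⟩ := h
    have hle : negCount M ≤ M.card := Multiset.countP_le_card _ _
    have hcons : negCount ((f, a) ::ₘ M) = negCount M + if a = 1 then 1 else 0 := by
      simp [negCount, Multiset.countP_cons]
    rw [hcons, Multiset.card_cons]
    conv_lhs => rw [ih h]
    rcases zmod_two_cases a with rfl | rfl
    · simp only [zero_ne_one, if_false, add_zero]
      rw [Nat.succ_sub hle, Multiset.replicate_succ, Multiset.add_cons]
    · simp only [if_true]
      rw [Nat.add_sub_add_right, Multiset.replicate_succ, Multiset.cons_add]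

lemma countP_le_countP {ι : Type*} {p q : ι → Prop} [DecidablePred p] [DecidablePred q]
    {M : Multiset ι} (h : ∀ e ∈ M, p e → q e) : M.countP p ≤ M.countP q := by
  induction M using Multiset.induction_on with
  | empty => simp
  | cons e M ih =>
    simp only [Multiset.mem_cons, forall_eq_or_imp] at h
    have := ih h.2
    have := h.1
    rw [Multiset.countP_cons, Multiset.countP_cons]
    split_ifs <;> first | omega | tauto

/-! ### Cuts and degrees -/

variable [DecidableEq α]

/-- `1` if the edge `e` has exactly one end in `X`, and `0` otherwise. -/
def crossing (X : Finset α) (e : Sym2 α) : ℕ :=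
  Sym2.lift ⟨fun x y => if x ∈ X ↔ y ∈ X then 0 else 1, fun x y => by simp only [iff_comm]⟩ e

/-- The number of ends of the edge `e` that are equal to `x`. -/
def ends (x : α) (e : Sym2 α) : ℕ :=
  Sym2.lift ⟨fun y z => (if y = x then 1 else 0) + (if z = x then 1 else 0),
    fun y z => by simp only [add_comm]⟩ e

@[simp] lemma crossing_mk (X : Finset α) (x y : α) :
    crossing X s(x, y) = if x ∈ X ↔ y ∈ X then 0 else 1 := rfl

@[simp] lemma ends_mk (x y z : α) :
    ends x s(y, z) = (if y = x then 1 else 0) + (if z = x then 1 else 0) := rfl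

/-- The size of the edge cut determined by `X`. -/
def cut (X : Finset α) (M : Multiset (SignedEdge α)) : ℕ :=
  (M.map fun e => crossing X e.1).sum

/-- The degree of the vertex `x`. -/
def degree (x : α) (M : Multiset (SignedEdge α)) : ℕ :=
  (M.map fun e => ends x e.1).sum

/-- The number of negative edges that are not incident with `v`. -/
def negCountOff (v : α) (M : Multiset (SignedEdge α)) : ℕ :=
  M.countP fun e => e.2 = 1 ∧ v ∉ e.1

@[simp] lemma cut_zero (X : Finset α) : cut X 0 = 0 := rfl

@[simp] lemma cut_cons (X : Finset α) (e : SignedEdge α) (M : Multiset (SignedEdge α)) :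
    cut X (e ::ₘ M) = crossing X e.1 + cut X M := by simp [cut]

@[simp] lemma degree_cons (x : α) (e : SignedEdge α) (M : Multiset (SignedEdge α)) :
    degree x (e ::ₘ M) = ends x e.1 + degree x M := by simp [degree]

/-- Submodularity, checked edge by edge. -/
lemma cut_union_add_cut_inter_le (X Y : Finset α) (M : Multiset (SignedEdge α)) :
    cut (X ∪ Y) M + cut (X ∩ Y) M ≤ cut X M + cut Y M := by
  unfold cut
  rw [← Multiset.sum_map_add (f := fun e : SignedEdge α => crossing X e.1)]
  refine sum_map_add_le fun e _ => ?_
  induction e.1 using Sym2.ind with | _ x y =>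
  simp only [crossing_mk, Finset.mem_union, Finset.mem_inter]
  split_ifs <;> first | omega | (exfalso; tauto)

lemma cut_sdiff_add_cut_sdiff_le (X Y : Finset α) (M : Multiset (SignedEdge α)) :
    cut (X \ Y) M + cut (Y \ X) M ≤ cut X M + cut Y M := by
  unfold cut
  rw [← Multiset.sum_map_add (f := fun e : SignedEdge α => crossing X e.1)]
  refine sum_map_add_le fun e _ => ?_
  induction e.1 using Sym2.ind with | _ x y =>
  simp only [crossing_mk, Finset.mem_sdiff]
  split_ifs <;> first | omega | (exfalso; tauto)

lemma cut_add_two_mul_count (v : α) (M : Multiset (SignedEdge α)) :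
    cut {v} M + 2 * M.countP (fun e => e.1 = s(v, v)) = degree v M := by
  induction M using Multiset.induction_on with
  | empty => simp [cut, degree]
  | cons e M ih =>
    obtain ⟨e, a⟩ := e
    rw [cut_cons, degree_cons, ← ih, Multiset.countP_cons]
    induction e using Sym2.ind with | _ x y =>
    simp only [crossing_mk, ends_mk, Finset.mem_singleton, Sym2.eq_iff]
    split_ifs <;> first | omega | (exfalso; tauto)

/-! ### Splitting off a vertex -/

/-- All cuts determined by non-empty proper subsets of `W` have at least six edges. -/
def SixCuts (W : Finset α) (M : Multiset (SignedEdge α)) : Prop :=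
  ∀ X ⊆ W, X.Nonempty → X ≠ W → 6 ≤ cut X M

/-- A six-edge-connected six-regular multigraph with vertex set `W`. -/
structure IsGood (W : Finset α) (M : Multiset (SignedEdge α)) : Prop where
  mem : ∀ e ∈ M, ∀ x ∈ e.1, x ∈ W
  even : ∀ X, Even (cut X M)
  deg : ∀ x ∈ W, degree x M = 6
  conn : SixCuts W M

/-- A multigraph arising from a good one in the course of splitting off the vertex `z`, where
`W` is the set of the other vertices. -/
structure IsPartial (W : Finset α) (z : α) (M : Multiset (SignedEdge α)) : Prop where
  notMem : z ∉ W
  mem : ∀ e ∈ M, ∀ x ∈ e.1, x ∈ insert z W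
  even : ∀ X, Even (cut X M)
  deg : ∀ x ∈ W, degree x M = 6
  conn : SixCuts W M
  loopless : ∀ e ∈ M, e.1 ≠ s(z, z)

/-- `M'` arises from `M` by splitting off a pair of edges at `z`. -/
def IsSplit (z : α) (M M' : Multiset (SignedEdge α)) : Prop :=
  ∃ s t a b M₀, s ≠ z ∧ t ≠ z ∧ M = (s(s, z), a) ::ₘ (s(t, z), b) ::ₘ M₀ ∧
    M' = (s(s, t), a + b) ::ₘ M₀

/-- `M'` arises from `M` by an admissible splitting at `z`. -/
def IsStep (W : Finset α) (z : α) (M M' : Multiset (SignedEdge α)) : Prop :=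
  IsSplit z M M' ∧ IsPartial W z M'

/-- A loop uses two of the six units of degree and none of the cut of `{v}`. Hence an admissible
splitting never merges two edges that both go to `v`. -/
lemma SixCuts.loopless {W : Finset α} {M : Multiset (SignedEdge α)} {v : α} (h : SixCuts W M)
    (hv : v ∈ W) (hW : W ≠ {v}) (hd : degree v M = 6) : ∀ e ∈ M, e.1 ≠ s(v, v) := by
  have h1 := h {v} (by simpa using hv) (by simp) hW.symm
  have h2 := cut_add_two_mul_count v M
  have h3 : M.countP (fun e => e.1 = s(v, v)) = 0 := by omega
  exact Multiset.countP_eq_zero.1 h3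

lemma IsSplit.even_cut {z : α} {M M' : Multiset (SignedEdge α)} (h : IsSplit z M M')
    (X : Finset α) : Even (cut X M') ↔ Even (cut X M) := by
  obtain ⟨s, t, a, b, M₀, -, -, rfl, rfl⟩ := h
  simp only [cut_cons, crossing_mk]
  split_ifs <;> simp only [Nat.even_add, Nat.not_even_one, Even.zero] <;> tauto

lemma IsSplit.degree_eq {z x : α} {M M' : Multiset (SignedEdge α)} (h : IsSplit z M M')
    (hx : x ≠ z) : degree x M' = degree x M := by
  obtain ⟨s, t, a, b, M₀, -, -, rfl, rfl⟩ := h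
  simp only [degree_cons, ends_mk, hx.symm, if_false]
  omega

lemma IsPartial.of_split {W : Finset α} {z : α} {M M' : Multiset (SignedEdge α)}
    (h : IsPartial W z M) (hs : IsSplit z M M') (hc : SixCuts W M') : IsPartial W z M' where
  notMem := h.notMem
  mem := by
    have hm := h.mem
    obtain ⟨s, t, a, b, M₀, -, -, rfl, rfl⟩ := hs
    simp only [Multiset.mem_cons, forall_eq_or_imp, Sym2.mem_iff] at hm ⊢
    exact ⟨⟨hm.1.1, fun x hx => hx ▸ hm.2.1.1⟩, hm.2.2⟩
  even X := (hs.even_cut X).2 (h.even X)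
  deg x hx := (hs.degree_eq (by rintro rfl; exact h.notMem hx)).trans (h.deg x hx)
  conn := hc
  loopless := by
    have hl := h.loopless
    obtain ⟨s, t, a, b, M₀, hs, ht, rfl, rfl⟩ := hs
    simp only [Multiset.mem_cons, forall_eq_or_imp] at hl ⊢
    exact ⟨by simp [hs], hl.2.2⟩

/-- The neighbours of `z` do not all lie in a proper subset of `W` whose cut has size six. -/
lemma not_all_in_tight {W X : Finset α} {z : α} {M : Multiset (SignedEdge α)}
    (h : IsPartial W z M) (hz : ∃ e ∈ M, z ∈ e.1) (hXW : X ⊆ W) (hX : X.Nonempty) (hne : X ≠ W)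
    (ht : cut X M ≤ 6) (hall : ∀ t b, (s(t, z), b) ∈ M → t ∈ X) : False := by
  have h1 : 6 ≤ cut (W \ X) M := by
    refine h.conn _ Finset.sdiff_subset ?_ ?_
    · rw [Finset.sdiff_nonempty]
      exact fun h' => hne (hXW.antisymm h')
    · intro h'
      obtain ⟨x, hx⟩ := hX
      have := hXW hx
      rw [← h'] at this
      exact (Finset.mem_sdiff.1 this).2 hx
  -- Edges at `z` cross `X` but not `W \ X`; all other edges lie within `W` and cross both sets or
  -- neither.
  have h2 : cut (W \ X) M + (M.map fun e => if z ∈ e.1 then 1 else 0).sum ≤ cut X M := by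
    refine sum_map_add_le ?_
    rintro ⟨e, b⟩ he
    have hm := h.mem _ he
    have hl := h.loopless _ he
    have hzW := h.notMem
    have hzX : z ∉ X := fun h' => hzW (hXW h')
    dsimp only at hm hl ⊢
    by_cases hze : z ∈ e
    · obtain ⟨t, rfl⟩ := Sym2.mem_iff_exists.1 hze
      have := hall t b (by rwa [Sym2.eq_swap])
      simp [this, hzX, hzW]
    · induction e using Sym2.ind with | _ x y =>
      simp only [Sym2.mem_iff, forall_eq_or_imp, forall_eq, not_or, Finset.mem_insert] at hm hze
      have hx : x ∈ W := by tauto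
      have hy : y ∈ W := by tauto
      simp [hx, hy, hze]
      split_ifs <;> first | omega | (exfalso; tauto)
  have h3 : 1 ≤ (M.map fun e => if z ∈ e.1 then 1 else 0).sum := by
    obtain ⟨e, he, hze⟩ := hz
    obtain ⟨M₁, rfl⟩ := Multiset.exists_cons_of_mem he
    simp [hze]
  omega

/-- Lovász's splitting lemma. -/
lemma IsPartial.exists_step {W : Finset α} {z : α} {M : Multiset (SignedEdge α)}
    (h : IsPartial W z M) (hz : ∃ e ∈ M, z ∈ e.1) : ∃ M', IsStep W z M M' := by
  by_contra! hno
  obtain ⟨s, a, M₁, hsz, hM⟩ := exists_cons_of_mem h.loopless hz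
  -- A cut decreases under the splitting only if it has both `s` and `t` inside, and then by two.
  -- Cuts being even, an obstructing set has size exactly six.
  have key : ∀ t b, (s(t, z), b) ∈ M₁ →
      ∃ X ⊆ W, s ∈ X ∧ t ∈ X ∧ X ≠ W ∧ cut X M = 6 := by
    intro t b htb
    obtain ⟨M₀, rfl⟩ := Multiset.exists_cons_of_mem htb
    have htz : t ≠ z := by
      rintro rfl
      exact h.loopless _ (hM ▸ Multiset.mem_cons_of_mem htb) rfl
    have hs : IsSplit z M ((s(s, t), a + b) ::ₘ M₀) := ⟨s, t, a, b, M₀, hsz, htz, hM, rfl⟩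
    have hc : ¬ SixCuts W ((s(s, t), a + b) ::ₘ M₀) := fun hc => hno _ ⟨hs, h.of_split hs hc⟩
    unfold SixCuts at hc
    push Not at hc
    obtain ⟨X, hXW, hX, hne, hlt⟩ := hc
    have h6 := h.conn X hXW hX hne
    have hev := h.even X
    have hzX : z ∉ X := fun h' => h.notMem (hXW h')
    rw [hM] at h6 hev
    simp only [cut_cons, crossing_mk, hzX, iff_false] at hlt h6 hev
    rw [Nat.even_iff] at hev
    have : s ∈ X ∧ t ∈ X := by
      by_contra hcon
      by_cases hsX : s ∈ X <;> by_cases htX : t ∈ X <;> simp [hsX, htX] at hlt h6 hev hcon <;>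
        omega
    obtain ⟨hsX, htX⟩ := this
    refine ⟨X, hXW, hsX, htX, hne, ?_⟩
    rw [hM]
    simp only [cut_cons, crossing_mk, hzX, iff_false]
    simp [hsX, htX] at hlt h6 hev ⊢
    omega
  -- The cut of `{z}` is even, so the edge `sz` is not alone at `z`.
  have hnon : ∃ t b, (s(t, z), b) ∈ M₁ := by
    by_contra! hcon
    have hev := h.even {z}
    have h0 : cut {z} M₁ = 0 := by
      refine Multiset.sum_eq_zero fun x hx => ?_
      obtain ⟨⟨e, b⟩, he, rfl⟩ := Multiset.mem_map.1 hx
      have hze : z ∉ e := fun hze => by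
        obtain ⟨t, rfl⟩ := Sym2.mem_iff_exists.1 hze
        exact hcon t b (by rwa [Sym2.eq_swap])
      induction e using Sym2.ind with | _ x y =>
      simp only [Sym2.mem_iff, not_or] at hze
      simp [Ne.symm hze.1, Ne.symm hze.2]
    simp [hM, h0, hsz] at hev
  -- A largest tight set containing `s` turns out to contain every neighbour of `z`, against
  -- `not_all_in_tight`.
  set T := W.powerset.filter fun X => s ∈ X ∧ X ≠ W ∧ cut X M = 6 with hT
  obtain ⟨X, hX, hmax⟩ := T.exists_max_image Finset.card (by
    obtain ⟨t, b, htb⟩ := hnon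
    obtain ⟨X, h1, h2, h3, h4, h5⟩ := key t b htb
    exact ⟨X, Finset.mem_filter.2 ⟨Finset.mem_powerset.2 h1, h2, h4, h5⟩⟩)
  simp only [hT, Finset.mem_filter, Finset.mem_powerset] at hX hmax
  obtain ⟨hXW, hsX, hne, htight⟩ := hX
  refine not_all_in_tight h hz hXW ⟨s, hsX⟩ hne htight.le fun t b htb => ?_
  rw [hM, Multiset.mem_cons] at htb
  rcases htb with htb | htb
  · have : t = s := by
      have := congrArg Prod.fst htb
      simp only [Sym2.eq_iff] at this
      rcases this with h | h
      · exact h.1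
      · exact (hsz h.2.symm).elim
    rwa [this]
  obtain ⟨Y, hYW, hsY, htY, hYne, hYtight⟩ := key t b htb
  by_contra htX
  by_cases hU : X ∪ Y = W
  -- The union is not proper here, so the differences are used instead. The edge `sz` crosses `X`
  -- and `Y` but neither difference; without it the inequality reads `6 + 6 ≤ 5 + 5`.
  · have hXY : ¬ X ⊆ Y := fun h' => hYne (by rwa [Finset.union_eq_right.2 h'] at hU)
    have h1 := h.conn (X \ Y) (Finset.sdiff_subset.trans hXW) (Finset.sdiff_nonempty.2 hXY)
      (fun h' => by
        have := hXW hsX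
        rw [← h'] at this
        exact (Finset.mem_sdiff.1 this).2 hsY)
    have h2 := h.conn (Y \ X) (Finset.sdiff_subset.trans hYW) ⟨t, by simp [htY, htX]⟩
      (fun h' => by
        have := hXW hsX
        rw [← h'] at this
        exact (Finset.mem_sdiff.1 this).2 hsX)
    have h3 := cut_sdiff_add_cut_sdiff_le X Y M₁
    have hzX : z ∉ X := fun h' => h.notMem (hXW h')
    have hzY : z ∉ Y := fun h' => h.notMem (hYW h')
    simp only [hM, cut_cons, crossing_mk, hzX, hzY, hsX, hsY, Finset.mem_sdiff] at h1 h2 htight hYtight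
    simp at h1 h2 htight hYtight
    omega
  -- Uncrossing makes `X ∪ Y` tight, so by maximality it equals `X`.
  · have h1 := h.conn (X ∪ Y) (Finset.union_subset hXW hYW) ⟨s, by simp [hsX]⟩ hU
    have h2 := h.conn (X ∩ Y) (Finset.inter_subset_left.trans hXW) ⟨s, by simp [hsX, hsY]⟩
      (fun h' => hne (hXW.antisymm (h' ▸ Finset.inter_subset_left)))
    have h3 := cut_union_add_cut_inter_le X Y M
    have h4 := hmax (X ∪ Y) ⟨Finset.union_subset hXW hYW, by simp [hsX], hU, by omega⟩
    have h5 := Finset.eq_of_subset_of_card_le Finset.subset_union_left h4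
    exact htX (h5 ▸ Finset.mem_union_right _ htY)

/-- Each splitting lowers the number of edges by one, so the process ends, with no edge left at `z`.
-/
lemma IsPartial.exists_complete {W : Finset α} {z : α} {M : Multiset (SignedEdge α)}
    (h : IsPartial W z M) : ∃ M', Relation.ReflTransGen (IsStep W z) M M' ∧ IsGood W M' := by
  induction hn : M.card using Nat.strong_induction_on generalizing M with | _ n ih =>
  by_cases hz : ∃ e ∈ M, z ∈ e.1
  · obtain ⟨M', hM'⟩ := h.exists_step hz
    have hlt : M'.card < n := by
      obtain ⟨⟨s, t, a, b, M₀, -, -, rfl, rfl⟩, -⟩ := hM'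
      simp only [Multiset.card_cons] at hn ⊢
      omega
    obtain ⟨M'', h1, h2⟩ := ih _ hlt hM'.2 rfl
    exact ⟨M'', h1.head hM', h2⟩
  · push Not at hz
    refine ⟨M, .refl, ⟨fun e he x hx => ?_, h.even, h.deg, h.conn⟩⟩
    rcases Finset.mem_insert.1 (h.mem e he x hx) with rfl | h'
    · exact (hz e he hx).elim
    · exact h'

lemma IsGood.loopless {W : Finset α} {v : α} {M : Multiset (SignedEdge α)} (h : IsGood W M)
    (hv : v ∈ W) (hW : 2 ≤ W.card) : ∀ e ∈ M, e.1 ≠ s(v, v) :=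
  h.conn.loopless hv (ne_singleton_of_two_le_card hW v) (h.deg v hv)

lemma IsGood.isPartial {W : Finset α} {z : α} {M : Multiset (SignedEdge α)} (h : IsGood W M)
    (hz : z ∈ W) (hW : 2 ≤ W.card) : IsPartial (W.erase z) z M where
  notMem := by simp
  mem := by simpa [Finset.insert_erase hz] using h.mem
  even := h.even
  deg x hx := h.deg x (Finset.mem_of_mem_erase hx)
  conn X hX hne hne' := h.conn X (hX.trans (Finset.erase_subset _ _)) hne (by
    rintro rfl
    exact absurd (hX hz) (by simp))
  loopless := h.loopless hz hW

/-! ### Rooted decompositions and undoing splittings -/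

/-- The edges of `N` form an eulerian signed multigraph with an odd number of negative edges
that remains connected when the vertex `r` is added to it. -/
structure IsOddRooted (r : α) (N : Multiset (SignedEdge α)) : Prop where
  even : ∀ X, Even (cut X N)
  parity_eq : parity N = 1
  conn : ∀ X, r ∉ X → cut X N = 0 → ∀ e ∈ N, ∀ x ∈ e.1, x ∉ X

/-- The signed multigraph `M` has a rooted 3-odd decomposition with root in `W`. -/
def HasRootedPartition (W : Finset α) (M : Multiset (SignedEdge α)) : Prop :=
  ∃ r ∈ W, ∃ N : Fin 3 → Multiset (SignedEdge α), ∑ i, N i = M ∧ ∀ i, IsOddRooted r (N i)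

lemma HasRootedPartition.mono {W W' : Finset α} {M : Multiset (SignedEdge α)}
    (h : HasRootedPartition W M) (hW : W ⊆ W') : HasRootedPartition W' M := by
  obtain ⟨r, hr, h⟩ := h
  exact ⟨r, hW hr, h⟩

/-- Stating connectedness by empty cuts makes this direct: an empty cut after unsplitting has `s`,
`t`, `z` on one side, so it was empty before, and `z` follows `s`. -/
lemma IsOddRooted.unsplit {r s t z : α} {a b : ZMod 2} {N : Multiset (SignedEdge α)}
    (h : IsOddRooted r ((s(s, t), a + b) ::ₘ N)) (hs : s ≠ z) (ht : t ≠ z) :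
    IsOddRooted r ((s(s, z), a) ::ₘ (s(t, z), b) ::ₘ N) where
  even X := by
    have hsp : IsSplit z ((s(s, z), a) ::ₘ (s(t, z), b) ::ₘ N) ((s(s, t), a + b) ::ₘ N) :=
      ⟨s, t, a, b, N, hs, ht, rfl, rfl⟩
    exact (hsp.even_cut X).1 (h.even X)
  parity_eq := by
    have := h.parity_eq
    simp only [parity_cons] at this ⊢
    rw [← this, add_assoc]
  conn X hr h0 := by
    simp only [cut_cons, crossing_mk, Nat.add_eq_zero_iff, ite_eq_left_iff, one_ne_zero,
      imp_false, not_not] at h0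
    obtain ⟨h1, h2, h3⟩ := h0
    have h4 := h.conn X hr (by simp [h3, h1, h2])
    simp only [Multiset.mem_cons, forall_eq_or_imp, Sym2.mem_iff, forall_eq] at h4 ⊢
    tauto

/-- The merged edge lies in one of the three classes, and only that class is modified. -/
lemma HasRootedPartition.unsplit {W : Finset α} {z : α} {M M' : Multiset (SignedEdge α)}
    (h : HasRootedPartition W M') (hs : IsSplit z M M') : HasRootedPartition W M := by
  obtain ⟨s, t, a, b, M₀, hsz, htz, rfl, rfl⟩ := hs
  obtain ⟨r, hr, N, hN, hodd⟩ := h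
  have hmem : (s(s, t), a + b) ∈ ∑ i, N i := by simp [hN]
  obtain ⟨i, -, hi⟩ := Multiset.mem_sum.1 hmem
  obtain ⟨N₀, hN₀⟩ := Multiset.exists_cons_of_mem hi
  refine ⟨r, hr, Function.update N i ((s(s, z), a) ::ₘ (s(t, z), b) ::ₘ N₀), ?_, fun j => ?_⟩
  · rw [Finset.sum_update_of_mem (Finset.mem_univ i)]
    rw [← Finset.add_sum_erase _ _ (Finset.mem_univ i), hN₀, Multiset.cons_add,
      Multiset.cons_inj_right, Finset.erase_eq] at hN
    rw [← hN, Multiset.cons_add, Multiset.cons_add]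
  · by_cases hj : j = i
    · subst hj
      rw [Function.update_self]
      exact (hN₀ ▸ hodd j).unsplit hsz htz
    · rw [Function.update_of_ne hj]
      exact hodd j

lemma HasRootedPartition.of_steps {W W' : Finset α} {z : α} {M M' : Multiset (SignedEdge α)}
    (h : HasRootedPartition W M') (hs : Relation.ReflTransGen (IsStep W' z) M M') :
    HasRootedPartition W M := by
  induction hs using Relation.ReflTransGen.head_induction_on with
  | refl => exact h
  | head h1 _ ih => exact ih.unsplit h1.1

/-! ### Switching -/

/-- Switch the signature at the vertices of `X`. -/
def switch (X : Finset α) (M : Multiset (SignedEdge α)) : Multiset (SignedEdge α) :=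
  M.map fun e => (e.1, e.2 + crossing X e.1)

@[simp] lemma switch_cons (X : Finset α) (e : SignedEdge α) (M : Multiset (SignedEdge α)) :
    switch X (e ::ₘ M) = (e.1, e.2 + crossing X e.1) ::ₘ switch X M := by simp [switch]

@[simp] lemma cut_switch (X Y : Finset α) (M : Multiset (SignedEdge α)) :
    cut X (switch Y M) = cut X M := by simp [cut, switch]

@[simp] lemma degree_switch (x : α) (Y : Finset α) (M : Multiset (SignedEdge α)) :
    degree x (switch Y M) = degree x M := by simp [degree, switch]

lemma parity_switch (X : Finset α) (M : Multiset (SignedEdge α)) :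
    parity (switch X M) = parity M + cut X M := by
  induction M using Multiset.induction_on with
  | empty => simp [parity, switch]
  | cons e M ih => simp [ih]; ring

lemma forall_mem_switch {X : Finset α} {M : Multiset (SignedEdge α)} (p : Sym2 α → Prop)
    (h : ∀ e ∈ M, p e.1) : ∀ e ∈ switch X M, p e.1 := by
  intro e he
  obtain ⟨f, hf, rfl⟩ := Multiset.mem_map.1 he
  exact h f hf

lemma switch_switch (X Y : Finset α) (M : Multiset (SignedEdge α)) :
    switch X (switch Y M) = switch (symmDiff X Y) M := by
  simp only [switch, Multiset.map_map]
  refine Multiset.map_congr rfl fun e _ => ?_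
  obtain ⟨e, a⟩ := e
  induction e using Sym2.ind with | _ x y =>
  simp only [Function.comp, crossing_mk, Finset.mem_symmDiff, Prod.mk.injEq, true_and, add_assoc,
    add_right_inj]
  by_cases h1 : x ∈ X <;> by_cases h2 : x ∈ Y <;> by_cases h3 : y ∈ X <;> by_cases h4 : y ∈ Y <;>
    simp [h1, h2, h3, h4] <;> rfl

lemma switch_self (X : Finset α) (M : Multiset (SignedEdge α)) :
    switch X (switch X M) = M := by
  rw [switch_switch, symmDiff_self]
  simp only [switch]
  refine (Multiset.map_congr rfl fun e _ => ?_).trans (Multiset.map_id _)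
  obtain ⟨e, a⟩ := e
  induction e using Sym2.ind with | _ x y => simp

lemma IsOddRooted.switch {r : α} {N : Multiset (SignedEdge α)} (h : IsOddRooted r N)
    (X : Finset α) : IsOddRooted r (switch X N) where
  even Y := by simpa using h.even Y
  parity_eq := by
    rw [parity_switch, h.parity_eq, (ZMod.natCast_eq_zero_iff_even).2 (h.even X), add_zero]
  conn Y hr h0 := by
    rw [cut_switch] at h0
    exact forall_mem_switch (fun e => ∀ x ∈ e, x ∉ Y) (h.conn Y hr h0)

lemma HasRootedPartition.switch {W : Finset α} {M : Multiset (SignedEdge α)}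
    (h : HasRootedPartition W M) (X : Finset α) : HasRootedPartition W (switch X M) := by
  obtain ⟨r, hr, N, rfl, hodd⟩ := h
  refine ⟨r, hr, fun i => SignedMultigraph.switch X (N i), ?_, fun i => (hodd i).switch X⟩
  simp [SignedMultigraph.switch, Fin.sum_univ_three]

lemma HasRootedPartition.of_switch {W : Finset α} {M : Multiset (SignedEdge α)} {X : Finset α}
    (h : HasRootedPartition W (SignedMultigraph.switch X M)) : HasRootedPartition W M := by
  simpa [switch_self] using h.switch X

lemma IsGood.switch {W : Finset α} {M : Multiset (SignedEdge α)} (h : IsGood W M)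
    (X : Finset α) : IsGood W (switch X M) where
  mem := forall_mem_switch (fun e => ∀ x ∈ e, x ∈ W) h.mem
  even Y := by simpa using h.even Y
  deg x hx := by simpa using h.deg x hx
  conn Y hY hne hne' := by simpa using h.conn Y hY hne hne'

/-- Up to switching, `M` has just one negative edge. -/
def IsAlmostBalanced (M : Multiset (SignedEdge α)) : Prop := ∃ X, negCount (switch X M) = 1

lemma IsAlmostBalanced.of_switch {X : Finset α} {M : Multiset (SignedEdge α)}
    (h : IsAlmostBalanced (switch X M)) : IsAlmostBalanced M := by
  obtain ⟨Y, hY⟩ := h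
  exact ⟨symmDiff Y X, by rwa [← switch_switch]⟩

lemma isAlmostBalanced_of_negCount {M : Multiset (SignedEdge α)} (h : negCount M = 1) :
    IsAlmostBalanced M := by
  -- Switching twice at `∅` gives back `M`.
  refine IsAlmostBalanced.of_switch (X := ∅) ⟨∅, ?_⟩
  rwa [switch_self]

/-! ### Three negative edges at a vertex -/

/-- A negative edge at `z` must be an edge `vz`. Two of them are never merged, since that would
create a loop at `v`; so each negative edge persists and stays at `v`. -/
lemma IsSplit.star {z v : α} {M M' : Multiset (SignedEdge α)} (hs : IsSplit z M M')
    (hzv : z ≠ v) (hl : ∀ e ∈ M', e.1 ≠ s(v, v)) (h0 : negCountOff v M = 0) :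
    negCount M' = negCount M ∧ negCountOff v M' = 0 := by
  obtain ⟨s, t, a, b, M₀, hsz, htz, rfl, rfl⟩ := hs
  have hl' := hl _ (Multiset.mem_cons_self _ _)
  simp only [negCountOff, negCount, Multiset.countP_cons, Sym2.mem_iff] at h0 ⊢
  have hst : ¬ (s = v ∧ t = v) := by rintro ⟨rfl, rfl⟩; exact hl' rfl
  rcases zmod_two_cases a with rfl | rfl <;> rcases zmod_two_cases b with rfl | rfl
  all_goals
    by_cases h1 : s = v <;> by_cases h2 : t = v <;>
    simp [h1, h2, eq_comm (a := v), hzv] at h0 hst ⊢ <;>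
    omega

lemma steps_star {W : Finset α} {z v : α} {M M' : Multiset (SignedEdge α)}
    (hs : Relation.ReflTransGen (IsStep W z) M M') (hv : v ∈ W) (hW : 2 ≤ W.card)
    (h0 : negCountOff v M = 0) : negCount M' = negCount M ∧ negCountOff v M' = 0 := by
  induction hs with
  | refl => exact ⟨rfl, h0⟩
  | tail _ h1 ih =>
    have hp := h1.2
    have h2 := h1.1.star (by rintro rfl; exact hp.notMem hv)
      (hp.conn.loopless hv (ne_singleton_of_two_le_card hW v) (hp.deg v hv)) ih.2
    exact ⟨h2.1.trans ih.1, h2.2⟩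

lemma degree_eq_countP {v : α} {M : Multiset (SignedEdge α)} (hl : ∀ e ∈ M, e.1 ≠ s(v, v)) :
    degree v M = M.countP fun e => v ∈ e.1 := by
  induction M using Multiset.induction_on with
  | empty => rfl
  | cons e M ih =>
    simp only [Multiset.mem_cons, forall_eq_or_imp] at hl
    rw [degree_cons, ih hl.2, Multiset.countP_cons, add_comm]
    obtain ⟨e, a⟩ := e
    obtain ⟨hl, -⟩ := hl
    induction e using Sym2.ind with | _ x y =>
    simp only [ends_mk, Sym2.mem_iff, ne_eq, Sym2.eq_iff, eq_comm (a := v)] at hl ⊢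
    split_ifs <;> first | omega | (exfalso; tauto)

lemma hasRootedPartition_of_star {W : Finset α} {v : α} {M : Multiset (SignedEdge α)}
    (h : IsGood W M) (hv : v ∈ W) (hW : 2 ≤ W.card) (h3 : negCount M = 3)
    (h0 : negCountOff v M = 0) : HasRootedPartition W M := by
  induction hn : W.card using Nat.strong_induction_on generalizing W M with | _ n ih =>
  obtain ⟨z, hz, hzv⟩ := Finset.exists_mem_ne (by omega : 1 < W.card) v
  have hv' : v ∈ W.erase z := Finset.mem_erase.2 ⟨hzv.symm, hv⟩
  have hcard := Finset.card_erase_of_mem hz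
  by_cases h2 : W.card = 2
  · have hW' : W = {v, z} := by
      refine (Finset.eq_of_subset_of_card_le ?_ ?_).symm
      · simp [Finset.insert_subset_iff, hv, hz]
      · rw [h2, Finset.card_pair hzv.symm]
    have hall : ∀ e ∈ M, e.1 = s(v, z) := by
      intro e he
      have h4 := h.mem e he
      have h5 := h.loopless hv hW e he
      have h6 := h.loopless hz hW e he
      obtain ⟨e, a⟩ := e
      induction e using Sym2.ind with | _ x y =>
      simp only [hW', Sym2.mem_iff, forall_eq_or_imp, forall_eq, Finset.mem_insert,
        Finset.mem_singleton] at h4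
      obtain ⟨rfl | rfl, rfl | rfl⟩ := h4
      · exact (h5 rfl).elim
      · rfl
      · exact Sym2.eq_swap
      · exact (h6 rfl).elim
    have hd := h.deg v hv
    rw [degree_eq_countP (h.loopless hv hW), Multiset.countP_eq_card.2
      (fun e he => by simp [hall e he])] at hd
    -- Six parallel edges, three of each sign: each negative edge is paired with a positive one.
    rw [eq_replicate_add hall, h3, hd]
    refine ⟨v, hv, fun _ => {(s(v, z), 1), (s(v, z), 0)}, ?_, fun _ => ⟨fun X => ?_, ?_, ?_⟩⟩
    · rw [Fin.sum_univ_three]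
      simp only [Multiset.insert_eq_cons, Multiset.replicate_succ, Multiset.replicate_zero,
        ← Multiset.singleton_add, Nat.reduceSub]
      abel
    · simp [Multiset.insert_eq_cons, ← Multiset.cons_zero]
    · simp [Multiset.insert_eq_cons, ← Multiset.cons_zero, parity]
    · intro X hvX hc
      simp [Multiset.insert_eq_cons, ← Multiset.cons_zero, hvX] at hc ⊢
      exact hc
  · obtain ⟨M', hs, hg⟩ := (h.isPartial hz hW).exists_complete
    obtain ⟨h3', h0'⟩ := steps_star hs hv' (by omega) h0
    exact ((ih _ (by omega) hg hv' (by omega) (h3'.trans h3) h0' rfl).of_steps hs).mono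
      (Finset.erase_subset _ _)

/-! ### Two negative edges at a vertex and one elsewhere -/

/-- The edge `e` misses `z`, so no splitting touches it; the remaining edges behave as in
`IsSplit.star`. -/
lemma steps_cons_star {W : Finset α} {z v : α} {e : SignedEdge α}
    {A M' : Multiset (SignedEdge α)} (hs : Relation.ReflTransGen (IsStep W z) (e ::ₘ A) M')
    (hv : v ∈ W) (hW : 2 ≤ W.card) (hze : z ∉ e.1) (h0 : negCountOff v A = 0) :
    ∃ A', M' = e ::ₘ A' ∧ negCount A' = negCount A ∧ negCountOff v A' = 0 := by
  induction hs with
  | refl => exact ⟨A, rfl, rfl, h0⟩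
  | tail _ h1 ih =>
    obtain ⟨B, rfl, hB, hB0⟩ := ih
    have hp := h1.2
    have hl := hp.conn.loopless hv (ne_singleton_of_two_le_card hW v) (hp.deg v hv)
    obtain ⟨⟨s, t, a, b, M₀, hsz, htz, h2, rfl⟩, -⟩ := h1
    have hmem : e ∈ M₀ := by
      have : e ∈ e ::ₘ B := Multiset.mem_cons_self _ _
      rw [h2, Multiset.mem_cons, Multiset.mem_cons] at this
      rcases this with rfl | rfl | h
      · simp at hze
      · simp at hze
      · exact h
    obtain ⟨B₀, rfl⟩ := Multiset.exists_cons_of_mem hmem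
    rw [Multiset.cons_swap _ e, Multiset.cons_swap _ e, Multiset.cons_inj_right] at h2
    refine ⟨(s(s, t), a + b) ::ₘ B₀, Multiset.cons_swap _ _ _, ?_⟩
    have hsp : IsSplit z B ((s(s, t), a + b) ::ₘ B₀) := ⟨s, t, a, b, B₀, hsz, htz, h2, rfl⟩
    have h3 := hsp.star (by rintro rfl; exact hp.notMem hv)
      (fun f hf => hl f (by rw [Multiset.cons_swap]; exact Multiset.mem_cons_of_mem hf)) hB0
    exact ⟨h3.1.trans hB, h3.2⟩

lemma exists_positive_edge {v : α} {A : Multiset (SignedEdge α)}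
    (hl : ∀ e ∈ A, e.1 ≠ s(v, v)) (h : negCount A < degree v A) :
    ∃ w, w ≠ v ∧ (s(v, w), 0) ∈ A := by
  by_contra! hcon
  refine h.not_ge ?_
  rw [degree_eq_countP hl]
  refine countP_le_countP fun e he hv => ?_
  obtain ⟨e, a⟩ := e
  obtain ⟨w, rfl⟩ := Sym2.mem_iff_exists.1 hv
  rcases zmod_two_cases a with rfl | rfl
  · exact (hcon w (by rintro rfl; exact hl _ he rfl) he).elim
  · rfl

/-- With only `v` and `y` left, the relevant cuts are those of single vertices, and trading `vx`,
`yx` for `vy` leaves them unchanged. So this prescribed first splitting is always admissible. -/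
lemma IsGood.isPartial_of_split {v x y : α} {a b : ZMod 2} {M₀ : Multiset (SignedEdge α)}
    (h : IsGood {v, x, y} ((s(v, x), a) ::ₘ (s(y, x), b) ::ₘ M₀))
    (hvx : v ≠ x) (hvy : v ≠ y) (hxy : x ≠ y) :
    IsPartial {v, y} x ((s(v, y), a + b) ::ₘ M₀) := by
  have hW : ({v, x, y} : Finset α).erase x = {v, y} := by
    ext u
    simp only [Finset.mem_erase, Finset.mem_insert, Finset.mem_singleton]
    constructor
    · tauto
    · rintro (rfl | rfl) <;> tauto
  have hcard : ({v, x, y} : Finset α).card = 3 := by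
    rw [Finset.card_insert_of_notMem (by simp [hvx, hvy]), Finset.card_pair hxy]
  have hp := h.isPartial (z := x) (by simp) (by omega)
  rw [hW] at hp
  refine hp.of_split ⟨v, y, a, b, M₀, hvx, hxy.symm, rfl, rfl⟩ ?_
  intro X hX hne hne'
  have hX1 : X.card = 1 := by
    have h1 := Finset.card_lt_card (hX.ssubset_of_ne hne')
    rw [Finset.card_pair hvy] at h1
    have := hne.card_pos
    omega
  obtain ⟨u, rfl⟩ := Finset.card_eq_one.1 hX1
  have hu : u = v ∨ u = y := by simpa using hX
  have h6 := h.conn {u} (by simp; tauto) (by simp) (fun h' => by rw [← h'] at hcard; simp at hcard)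
  simp only [cut_cons, crossing_mk, Finset.mem_singleton] at h6 ⊢
  rcases hu with rfl | rfl
  · simpa [hvx.symm, hvy.symm] using h6
  · simpa [hvy, hxy, add_comm, add_assoc] using h6

/-- Merging the positive edge `vx` with the negative edge `xy` produces a third negative edge at
`v`. -/
lemma hasRootedPartition_of_cons {v x y : α} {A : Multiset (SignedEdge α)}
    (h : IsGood {v, x, y} ((s(x, y), 1) ::ₘ A)) (hvx : v ≠ x) (hvy : v ≠ y) (hxy : x ≠ y)
    (hA : (s(v, x), 0) ∈ A) (h2 : negCount A = 2) (h0 : negCountOff v A = 0) :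
    HasRootedPartition {v, x, y} ((s(x, y), 1) ::ₘ A) := by
  obtain ⟨A₀, rfl⟩ := Multiset.exists_cons_of_mem hA
  rw [Multiset.cons_swap, Sym2.eq_swap (a := x)] at h ⊢
  have hp := h.isPartial_of_split hvx hvy hxy
  have hs : IsSplit x ((s(v, x), 0) ::ₘ (s(y, x), 1) ::ₘ A₀) ((s(v, y), 0 + 1) ::ₘ A₀) :=
    ⟨v, y, 0, 1, A₀, hvx, hxy.symm, rfl, rfl⟩
  obtain ⟨M', hst, hg⟩ := hp.exists_complete
  have hn : negCount ((s(v, y), 0 + 1) ::ₘ A₀) = 3 := by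
    simpa [negCount, Multiset.countP_cons] using h2
  have hn0 : negCountOff v ((s(v, y), 0 + 1) ::ₘ A₀) = 0 := by
    simpa [negCountOff, Multiset.countP_cons] using h0
  have hc : 2 ≤ ({v, y} : Finset α).card := (Finset.card_pair hvy).ge
  obtain ⟨h3', h0'⟩ := steps_star hst (by simp) hc hn0
  refine ((hasRootedPartition_of_star hg (by simp) hc (h3'.trans hn) h0').of_steps
    (.head ⟨hs, hp⟩ hst)).mono ?_
  simp [Finset.insert_subset_iff]

lemma hasRootedPartition_of_cons_star {W : Finset α} {v : α} {e : SignedEdge α}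
    {A : Multiset (SignedEdge α)} (h : IsGood W (e ::ₘ A)) (hv : v ∈ W) (hW : 2 ≤ W.card)
    (he : e.2 = 1) (hve : v ∉ e.1) (h2 : negCount A = 2) (h0 : negCountOff v A = 0) :
    HasRootedPartition W (e ::ₘ A) := by
  induction hn : W.card using Nat.strong_induction_on generalizing W A with | _ n ih =>
  obtain ⟨e, a⟩ := e
  obtain rfl : a = 1 := he
  induction e using Sym2.ind with | _ x y =>
  have hmem := h.mem _ (Multiset.mem_cons_self _ _)
  simp only [Sym2.mem_iff, forall_eq_or_imp, forall_eq, not_or] at hmem hve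
  obtain ⟨hx, hy⟩ := hmem
  obtain ⟨hvx, hvy⟩ := hve
  have hxy : x ≠ y := by
    rintro rfl
    exact h.loopless hx hW _ (Multiset.mem_cons_self _ _) rfl
  have hsub : ({v, x, y} : Finset α) ⊆ W := by simp [Finset.insert_subset_iff, hv, hx, hy]
  by_cases hz : ∃ z ∈ W, z ∉ ({v, x, y} : Finset α)
  · obtain ⟨z, hzW, hz⟩ := hz
    have hcard := Finset.card_erase_of_mem hzW
    have hlt : 3 < W.card := by
      have h4 := Finset.card_lt_card (Finset.ssubset_iff_subset_ne.2
        ⟨hsub, fun h' => hz (h' ▸ hzW)⟩)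
      rwa [Finset.card_insert_of_notMem (by simp [hvx, hvy]), Finset.card_pair hxy] at h4
    simp only [Finset.mem_insert, Finset.mem_singleton, not_or] at hz
    have hv' : v ∈ W.erase z := Finset.mem_erase.2 ⟨Ne.symm hz.1, hv⟩
    obtain ⟨M', hs, hg⟩ := (h.isPartial hzW hW).exists_complete
    obtain ⟨A', rfl, h2', h0'⟩ := steps_cons_star hs hv' (by omega) (by simp [hz]) h0
    exact ((ih _ (by omega) hg hv' (by omega) (h2'.trans h2) h0' rfl).of_steps hs).mono
      (Finset.erase_subset _ _)
  · push Not at hz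
    obtain rfl : W = {v, x, y} := Finset.Subset.antisymm hz hsub
    have hl := h.loopless hv hW
    have hd := h.deg v hv
    rw [degree_cons] at hd
    simp only [ends_mk, Ne.symm hvx, Ne.symm hvy, if_false] at hd
    -- Six edges of `A` meet `v` and only two edges of `A` are negative.
    obtain ⟨w, hwv, hw⟩ := exists_positive_edge (v := v) (A := A)
      (fun f hf => hl f (Multiset.mem_cons_of_mem hf)) (by omega)
    have hwW := h.mem _ (Multiset.mem_cons_of_mem hw) w (by simp)
    simp only [Finset.mem_insert, Finset.mem_singleton] at hwW
    rcases hwW with rfl | rfl | rfl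
    · exact (hwv rfl).elim
    · exact hasRootedPartition_of_cons h hvx hvy hxy hw h2 h0
    · rw [Sym2.eq_swap, Finset.pair_comm] at h ⊢
      exact hasRootedPartition_of_cons h hvy hvx hxy.symm hw h2 h0

lemma hasRootedPartition_of_negCountOff {W : Finset α} {v : α} {M : Multiset (SignedEdge α)}
    (h : IsGood W M) (hv : v ∈ W) (hW : 2 ≤ W.card) (h3 : negCount M = 3)
    (h1 : negCountOff v M ≤ 1) : HasRootedPartition W M := by
  rcases Nat.le_one_iff_eq_zero_or_eq_one.1 h1 with h0 | h1
  · exact hasRootedPartition_of_star h hv hW h3 h0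
  · obtain ⟨e, he, he1, hve⟩ := Multiset.countP_pos.1 (by
      rw [← negCountOff, h1]; exact one_pos : 0 < M.countP fun e => e.2 = 1 ∧ v ∉ e.1)
    obtain ⟨A, rfl⟩ := Multiset.exists_cons_of_mem he
    refine hasRootedPartition_of_cons_star h hv hW he1 hve ?_ ?_
    · simpa [negCount, Multiset.countP_cons, he1] using h3
    · simpa [negCountOff, Multiset.countP_cons, he1, hve] using h1

/-! ### The main theorem for multisets of edges -/

/-- Edges away from `z` are kept with their signs, whatever the switching; only a new edge may be
added to the count. -/
lemma IsSplit.negCountOff_switch_le {z : α} {M M' : Multiset (SignedEdge α)}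
    (h : IsSplit z M M') (X : Finset α) :
    negCountOff z (switch X M) ≤ negCountOff z (switch X M') := by
  obtain ⟨s, t, a, b, M₀, hs, ht, rfl, rfl⟩ := h
  simp [negCountOff, Multiset.countP_cons]

lemma steps_negCountOff_switch_le {W : Finset α} {z : α} {M M' : Multiset (SignedEdge α)}
    (h : Relation.ReflTransGen (IsStep W z) M M') (X : Finset α) :
    negCountOff z (switch X M) ≤ negCountOff z (switch X M') := by
  induction h with
  | refl => exact le_rfl
  | tail _ h1 ih => exact ih.trans (h1.1.negCountOff_switch_le X)

lemma steps_parity {W : Finset α} {z : α} {M M' : Multiset (SignedEdge α)}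
    (h : Relation.ReflTransGen (IsStep W z) M M') : parity M' = parity M := by
  induction h with
  | refl => rfl
  | tail _ h1 ih =>
    obtain ⟨⟨s, t, a, b, M₀, hs, ht, rfl, rfl⟩, -⟩ := h1
    rw [← ih]
    simp [add_assoc]

lemma negCountOff_switch_singleton (v : α) (M : Multiset (SignedEdge α)) :
    negCountOff v (switch {v} M) = negCountOff v M := by
  rw [negCountOff, negCountOff, switch, Multiset.countP_map, ← Multiset.countP_eq_card_filter]
  refine Multiset.countP_congr rfl fun e _ => ?_
  obtain ⟨e, a⟩ := e
  induction e using Sym2.ind with | _ x y =>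
  simp only [Sym2.mem_iff, crossing_mk, Finset.mem_singleton, eq_comm (a := v)]
  by_cases hx : x = v <;> by_cases hy : y = v <;> simp [hx, hy]

/-- An edge at `v` is negative exactly once, before or after switching; a negative edge away from
`v` is counted twice. -/
lemma negCount_add_negCount_switch {v : α} {M : Multiset (SignedEdge α)}
    (hl : ∀ e ∈ M, e.1 ≠ s(v, v)) :
    negCount M + negCount (switch {v} M) = degree v M + 2 * negCountOff v M := by
  induction M using Multiset.induction_on with
  | empty => rfl
  | cons e M ih =>
    simp only [Multiset.mem_cons, forall_eq_or_imp] at hl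
    have ih := ih hl.2
    obtain ⟨e, a⟩ := e
    obtain ⟨hl, -⟩ := hl
    induction e using Sym2.ind with | _ x y =>
    simp only [switch_cons, degree_cons, negCount, negCountOff, Multiset.countP_cons, ends_mk,
      crossing_mk, Sym2.mem_iff, Finset.mem_singleton] at ih hl ⊢
    by_cases hx : x = v <;> by_cases hy : y = v <;> rcases zmod_two_cases a with rfl | rfl <;>
      simp [hx, hy, eq_comm (a := v), show (1 + 1 : ZMod 2) = 0 from rfl] at hl ⊢ <;> omega

/-- The numbers of negative edges before and after switching at `v` sum to 6 or 8. Both are odd and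
neither is 1, so one of them is 3. -/
lemma hasRootedPartition_of_negCountOff_le_one {W : Finset α} {v : α}
    {M : Multiset (SignedEdge α)} (h : IsGood W M) (hv : v ∈ W) (hW : 2 ≤ W.card)
    (hodd : parity M = 1) (hab : ¬ IsAlmostBalanced M) (h1 : negCountOff v M ≤ 1) :
    HasRootedPartition W M := by
  have hne : negCount M ≠ 1 := fun h' => hab (isAlmostBalanced_of_negCount h')
  have hne' : negCount (switch {v} M) ≠ 1 := fun h' => hab ⟨_, h'⟩
  have hsum := negCount_add_negCount_switch (h.loopless hv hW)
  rw [h.deg v hv] at hsum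
  have hoddn : Odd (negCount M) := by
    rwa [parity_eq_negCount, ZMod.natCast_eq_one_iff_odd] at hodd
  rw [Nat.odd_iff] at hoddn
  by_cases h3 : negCount M = 3
  · exact hasRootedPartition_of_negCountOff h hv hW h3 h1
  · refine (hasRootedPartition_of_negCountOff (h.switch {v}) hv hW (by omega) ?_).of_switch
    rwa [negCountOff_switch_singleton]

lemma hasRootedPartition_of_card_eq_one {W : Finset α} {M : Multiset (SignedEdge α)}
    (h : IsGood W M) (hW : W.card = 1) (hodd : parity M = 1) (hab : ¬ IsAlmostBalanced M) :
    HasRootedPartition W M := by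
  obtain ⟨v, rfl⟩ := Finset.card_eq_one.1 hW
  have hall : ∀ e ∈ M, e.1 = s(v, v) := by
    rintro ⟨e, a⟩ he
    have h4 := h.mem _ he
    induction e using Sym2.ind with | _ x y =>
    simp only [Sym2.mem_iff, forall_eq_or_imp, forall_eq, Finset.mem_singleton] at h4
    simp [h4]
  -- Degree six with an empty cut means three loops; all are negative, since one negative loop is
  -- excluded.
  have hcard : M.card = 3 := by
    have h1 := cut_add_two_mul_count v M
    have h2 : cut {v} M = 0 := by
      refine Multiset.sum_eq_zero fun x hx => ?_
      obtain ⟨e, he, rfl⟩ := Multiset.mem_map.1 hx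
      simp [hall e he]
    rw [h.deg v (by simp), h2, Multiset.countP_eq_card.2 hall] at h1
    omega
  have hne : negCount M ≠ 1 := fun h' => hab (isAlmostBalanced_of_negCount h')
  have hoddn : Odd (negCount M) := by
    rwa [parity_eq_negCount, ZMod.natCast_eq_one_iff_odd] at hodd
  have hle : negCount M ≤ M.card := Multiset.countP_le_card _ _
  rw [Nat.odd_iff] at hoddn
  have h3 : negCount M = 3 := by omega
  rw [eq_replicate_add hall, h3, hcard]
  refine ⟨v, by simp, fun _ => {(s(v, v), 1)}, by rw [Fin.sum_univ_three]; rfl, fun _ => ?_⟩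
  refine ⟨fun X => by simp [← Multiset.cons_zero], by simp [parity], fun X hX _ => ?_⟩
  simpa using hX

theorem hasRootedPartition {W : Finset α} {M : Multiset (SignedEdge α)} (h : IsGood W M)
    (hW : W.Nonempty) (hodd : parity M = 1) (hab : ¬ IsAlmostBalanced M) :
    HasRootedPartition W M := by
  induction hn : W.card using Nat.strong_induction_on generalizing W M with | _ n ih =>
  have hpos := hW.card_pos
  by_cases h1 : W.card = 1
  · exact hasRootedPartition_of_card_eq_one h h1 hodd hab
  obtain ⟨v, hv⟩ := hW
  have hcard := Finset.card_erase_of_mem hv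
  have hW2 : 2 ≤ W.card := by omega
  obtain ⟨M', hs, hg⟩ := (h.isPartial hv hW2).exists_complete
  by_cases hab' : IsAlmostBalanced M'
  · obtain ⟨X, hX⟩ := hab'
    -- The switching that exposes a single negative edge after the splitting is applied before it.
    have hle : negCountOff v (switch X M) ≤ 1 := by
      refine (steps_negCountOff_switch_le hs X).trans (hX ▸ ?_)
      exact countP_le_countP fun e _ he => he.1
    refine (hasRootedPartition_of_negCountOff_le_one (h.switch X) hv hW2 ?_
      (fun h' => hab h'.of_switch) hle).of_switch
    rw [parity_switch, hodd, (ZMod.natCast_eq_zero_iff_even).2 (h.even X), add_zero]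
  · exact ((ih _ (by omega) hg (Finset.card_pos.1 (by omega)) ((steps_parity hs).trans hodd)
      hab' rfl).of_steps hs).mono (Finset.erase_subset _ _)

end SignedMultigraph

/-! ### Passing between graphs and multisets of signed edges -/

namespace SignedMultigraph

lemma exists_add_of_map_eq_add {ι κ : Type*} (g : ι → κ) {s : Multiset ι} {A B : Multiset κ}
    (h : s.map g = A + B) : ∃ a b, s = a + b ∧ a.map g = A ∧ b.map g = B := by
  classical
  induction A using Multiset.induction_on generalizing s with
  | empty => exact ⟨0, s, by simp, rfl, by simpa using h⟩
  | cons x A ih =>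
    rw [Multiset.cons_add] at h
    have hx : x ∈ s.map g := h ▸ Multiset.mem_cons_self _ _
    obtain ⟨i, hi, rfl⟩ := Multiset.mem_map.1 hx
    obtain ⟨s, rfl⟩ := Multiset.exists_cons_of_mem hi
    rw [Multiset.map_cons, Multiset.cons_inj_right] at h
    obtain ⟨a, b, rfl, rfl, rfl⟩ := ih h
    exact ⟨i ::ₘ a, b, by simp, by simp, rfl⟩

/-- Parallel edges of equal sign coincide in the multiset, so the decomposition has to be lifted to
actual edges. -/
lemma exists_partition_of_map_eq_sum {ι κ : Type*} (g : ι → κ) {S : Finset ι}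
    {N : Fin 3 → Multiset κ} (h : ∑ i, N i = S.val.map g) :
    ∃ P : Fin 3 → Finset ι, (Pairwise fun i j => Disjoint (P i) (P j)) ∧
      (∀ e, e ∈ S ↔ ∃ i, e ∈ P i) ∧ ∀ i, (P i).val.map g = N i := by
  rw [Fin.sum_univ_three] at h
  obtain ⟨s, c, hs, hs', hc⟩ := exists_add_of_map_eq_add g h.symm
  obtain ⟨a, b, rfl, ha, hb⟩ := exists_add_of_map_eq_add g hs'
  have hnd := S.nodup
  rw [hs, Multiset.nodup_add, Multiset.nodup_add] at hnd
  obtain ⟨⟨hna, hnb, hab⟩, hnc, habc⟩ := hnd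
  rw [Multiset.disjoint_add_left] at habc
  refine ⟨![⟨a, hna⟩, ⟨b, hnb⟩, ⟨c, hnc⟩], ?_, fun e => ?_, ?_⟩
  · have h1 : Disjoint (⟨a, hna⟩ : Finset ι) ⟨b, hnb⟩ := Finset.disjoint_val.1 hab
    have h2 : Disjoint (⟨a, hna⟩ : Finset ι) ⟨c, hnc⟩ := Finset.disjoint_val.1 habc.1
    have h3 : Disjoint (⟨b, hnb⟩ : Finset ι) ⟨c, hnc⟩ := Finset.disjoint_val.1 habc.2
    intro i j hij
    fin_cases i <;> fin_cases j <;> first | exact (hij rfl).elim | assumption | exact Disjoint.symm ‹_›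
  · rw [← Finset.mem_val, hs]
    simp [Fin.exists_fin_succ, or_assoc]
  · intro i
    fin_cases i <;> assumption

variable {α β : Type*}

/-- The signed edges with ends given by `f` and signs given by `σ`. -/
def edgeMultiset (f : β → Sym2 α) (σ : β → ℤˣ) (S : Finset β) : Multiset (SignedEdge α) :=
  S.val.map fun e => (f e, if σ e = -1 then 1 else 0)

lemma parity_edgeMultiset (f : β → Sym2 α) (σ : β → ℤˣ) (S : Finset β) :
    parity (edgeMultiset f σ S) = (S.filter fun e => σ e = -1).card := by
  rw [Finset.natCast_card_filter, parity, edgeMultiset, Multiset.map_map, Finset.sum]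
  rfl

lemma exists_ends (G : Graph α β) (hne : (V(G)).Nonempty) :
    ∃ f : β → Sym2 α, ∀ e x y, G.IsLink e x y ↔ e ∈ E(G) ∧ f e = s(x, y) := by
  obtain ⟨v, -⟩ := hne
  have : ∀ e, ∃ p : Sym2 α, ∀ x y, G.IsLink e x y ↔ e ∈ E(G) ∧ p = s(x, y) := by
    intro e
    by_cases he : e ∈ E(G)
    · obtain ⟨a, b, hab⟩ := G.exists_isLink_of_mem_edgeSet he
      refine ⟨s(a, b), fun x y => ?_⟩
      rw [hab.isLink_iff_sym2_eq]
      simp [he]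
    -- An arbitrary value off the edge set.
    · exact ⟨s(v, v), fun x y => ⟨fun h => (he h.edge_mem).elim, fun h => (he h.1).elim⟩⟩
  choose f hf using this
  exact ⟨f, hf⟩

variable [DecidableEq α]

lemma cut_edgeMultiset (f : β → Sym2 α) (σ : β → ℤˣ) (S : Finset β) (X : Finset α) :
    cut X (edgeMultiset f σ S) = (S.filter fun e => crossing X (f e) = 1).card := by
  rw [Finset.card_filter, cut, edgeMultiset, Multiset.map_map, Finset.sum]
  refine congrArg Multiset.sum (Multiset.map_congr rfl fun e _ => ?_)
  simp only [Function.comp]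
  induction f e using Sym2.ind with | _ x y =>
  simp only [crossing_mk]
  split_ifs <;> simp_all

lemma negCount_switch_edgeMultiset (f : β → Sym2 α) (σ : β → ℤˣ) (S : Finset β) (X : Finset α) :
    negCount (switch X (edgeMultiset f σ S)) =
      (S.filter fun e => (if σ e = -1 then 1 else 0) + (crossing X (f e) : ZMod 2) = 1).card := by
  rw [negCount, switch, edgeMultiset, Multiset.map_map, Multiset.countP_map]
  rfl

lemma even_cut_of_even_degree {M : Multiset (SignedEdge α)} (h : ∀ x, Even (degree x M))
    (X : Finset α) : Even (cut X M) := by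
  -- Handshake argument: edges inside `X` contribute two to the degree sum, crossing edges one.
  have key : Even (cut X M) ↔ Even (∑ x ∈ X, degree x M) := by
    clear h
    induction M using Multiset.induction_on with
    | empty => simp [degree]
    | cons e M ih =>
      obtain ⟨e, a⟩ := e
      induction e using Sym2.ind with | _ y z =>
      simp only [cut_cons, degree_cons, crossing_mk, ends_mk, Finset.sum_add_distrib,
        Finset.sum_ite_eq, Nat.even_add, ih]
      split_ifs <;> simp_all
  rw [key]
  exact Finset.even_sum _ fun x _ => h x

lemma ends_eq (v : α) (e : Sym2 α) :
    ends v e = (if v ∈ e then 1 else 0) + (if e = s(v, v) then 1 else 0) := by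
  induction e using Sym2.ind with | _ x y =>
  simp only [ends_mk, Sym2.mem_iff, Sym2.eq_iff, eq_comm (a := v)]
  by_cases hx : x = v <;> by_cases hy : y = v <;> simp [hx, hy]

/-- If the links of `D` are given by `f` and `S`, its degrees are those of the edge multiset. -/
lemma deg_eq_degree {D : Graph α β} {f : β → Sym2 α} {S : Finset β} (σ : β → ℤˣ)
    (hD : ∀ e x y, D.IsLink e x y ↔ e ∈ S ∧ f e = s(x, y)) (v : α) :
    D.deg v = degree v (edgeMultiset f σ S) := by
  have h1 : D.incidenceSet v = ↑(S.filter fun e => v ∈ f e) := by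
    ext e
    simp [Graph.Inc, hD, Sym2.mem_iff_exists]
  have h2 : D.loopSet v = ↑(S.filter fun e => f e = s(v, v)) := by
    ext e
    simp [← Graph.isLink_self_iff, hD]
  rw [Graph.deg, h1, h2, Set.ncard_coe_finset, Set.ncard_coe_finset, Finset.card_filter,
    Finset.card_filter, ← Finset.sum_add_distrib, degree, edgeMultiset, Multiset.map_map]
  refine congrArg Multiset.sum (Multiset.map_congr rfl fun e _ => ?_)
  exact (ends_eq v (f e)).symm

/-- If fewer than six edges left `X`, deleting them would trap every walk starting in `X`. -/
lemma sixCuts_of_isEdgeConnected {G : Graph α β} {f : β → Sym2 α} (σ : β → ℤˣ)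
    {W : Finset α} {S : Finset β} (hW : ∀ x, x ∈ W ↔ x ∈ V(G)) (hS : ∀ e, e ∈ S ↔ e ∈ E(G))
    (hf : ∀ e x y, G.IsLink e x y ↔ e ∈ S ∧ f e = s(x, y)) (h : G.IsEdgeConnected 6) :
    SixCuts W (edgeMultiset f σ S) := by
  intro X hX ⟨u, hu⟩ hne
  rw [cut_edgeMultiset]
  by_contra! hlt
  set F := S.filter fun e => crossing X (f e) = 1 with hF
  have hcon := h.2.2 (F : Set β) (fun e he => (hS e).1 (Finset.mem_filter.1 he).1) (by
    rw [Set.encard_coe_eq_coe_finsetCard]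
    exact_mod_cast hlt)
  obtain ⟨w, hw, hwX⟩ : ∃ w ∈ W, w ∉ X := by
    by_contra! h'
    exact hne (Finset.Subset.antisymm hX h')
  have hpath := hcon.2 u ((hW u).1 (hX hu)) w ((hW w).1 hw)
  refine hwX ?_
  clear hwX hw
  induction hpath with
  | refl => exact hu
  | tail _ hab ih =>
    obtain ⟨e, he⟩ := hab
    rw [Graph.deleteEdges_isLink] at he
    obtain ⟨he, heF⟩ := he
    by_contra hb
    rw [hf] at he
    refine heF ?_
    simp [hF, he.1, he.2, ih, hb]

/-- Switching preserves the sign parity of a closed trail, so an unbalanced circuit always retains a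
negative edge. -/
lemma exists_edge_of_isUnbalancedCircuit {G : Graph α β} {f : β → Sym2 α} {σ : β → ℤˣ}
    {S : Finset β} (hf : ∀ e x y, G.IsLink e x y ↔ e ∈ S ∧ f e = s(x, y)) {T : G.Trail}
    (hT : T.IsUnbalancedCircuit σ) (X : Finset α) :
    ∃ e ∈ T.edges, e ∈ S ∧
      (if σ e = -1 then 1 else 0) + (crossing X (f e) : ZMod 2) = 1 := by
  by_contra! hcon
  have hz : ∀ i, (if σ (T.edge i) = -1 then 1 else 0) + (crossing X (f (T.edge i)) : ZMod 2) = 0 :=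
    fun i => (zmod_two_cases _).resolve_right
      (hcon _ ⟨i, rfl⟩ ((hf _ _ _).1 (T.isLink i)).1)
  have hsum := Finset.sum_eq_zero fun i (_ : i ∈ Finset.univ) => hz i
  rw [Finset.sum_add_distrib] at hsum
  have h1 : ∑ i, (if σ (T.edge i) = -1 then 1 else 0 : ZMod 2) = 1 := by
    have hodd := hT.2
    have himg : {e ∈ T.edges | σ e = -1} =
        T.edge '' ↑(Finset.univ.filter fun i => σ (T.edge i) = -1) := by
      ext e
      constructor
      · rintro ⟨⟨i, rfl⟩, hi⟩
        exact ⟨i, by simpa using hi, rfl⟩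
      · rintro ⟨i, hi, rfl⟩
        exact ⟨⟨i, rfl⟩, by simpa using hi⟩
    rw [himg, Set.ncard_image_of_injective _ T.edge_injective, Set.ncard_coe_finset] at hodd
    rw [← Finset.natCast_card_filter]
    exact ZMod.natCast_eq_one_iff_odd.2 hodd
  have h2 : ∑ i, (crossing X (f (T.edge i)) : ZMod 2) = 0 := by
    -- Crossing is the coboundary of the indicator of `X`, so its sum around a closed trail vanishes
    -- modulo 2.
    set g : α → ZMod 2 := fun x => if x ∈ X then 1 else 0 with hg
    have hstep : ∀ i, (crossing X (f (T.edge i)) : ZMod 2) =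
        g (T.vert i.castSucc) + g (T.vert i.succ) := by
      intro i
      rw [((hf _ _ _).1 (T.isLink i)).2, crossing_mk]
      by_cases ha : T.vert i.castSucc ∈ X <;> by_cases hb : T.vert i.succ ∈ X <;>
        simp [hg, ha, hb]
      rfl
    have hclosed : T.vert 0 = T.vert (Fin.last T.length) := hT.1.1
    have e1 := Fin.sum_univ_castSucc fun i => g (T.vert i)
    have e2 := Fin.sum_univ_succ fun i => g (T.vert i)
    rw [Finset.sum_congr rfl fun i _ => hstep i, Finset.sum_add_distrib]
    have e3 : ∑ i : Fin T.length, g (T.vert i.castSucc) = ∑ i : Fin T.length, g (T.vert i.succ) := by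
      have := e1.symm.trans e2
      rw [hclosed, add_comm] at this
      exact add_left_cancel this
    rw [e3, CharTwo.add_self_eq_zero]
  rw [h1, h2] at hsum
  exact one_ne_zero (hsum.symm.trans (add_zero 1)).symm

/-- The graph with edge set `S` and ends given by `f` whose vertices are `r` and the ends of
the edges. -/
def ofEnds (f : β → Sym2 α) (r : α) (S : Finset β) : Graph α β where
  vertexSet := {x | x = r ∨ ∃ e ∈ S, x ∈ f e}
  edgeSet := S
  IsLink e x y := e ∈ S ∧ f e = s(x, y)
  isLink_symm e _ := ⟨fun x y h => ⟨h.1, h.2.trans Sym2.eq_swap⟩⟩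
  eq_or_eq_of_isLink_of_isLink e x y v w h h' := by
    have := h.2.symm.trans h'.2
    rw [Sym2.eq_iff] at this
    tauto
  edge_mem_iff_exists_isLink e := by
    refine ⟨fun he => ?_, fun ⟨x, y, h⟩ => h.1⟩
    obtain ⟨x, y, hxy⟩ : ∃ x y, f e = s(x, y) := by
      induction f e using Sym2.ind with | _ x y => exact ⟨x, y, rfl⟩
    exact ⟨x, y, he, hxy⟩
  left_mem_of_isLink e x y h := .inr ⟨e, h.1, by simp [h.2]⟩

lemma ofEnds_isEulerian {f : β → Sym2 α} {σ : β → ℤˣ} {r : α} {S : Finset β}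
    (h : IsOddRooted r (edgeMultiset f σ S)) {U : Finset α} (hU : ∀ e ∈ S, ∀ x ∈ f e, x ∈ U) :
    (ofEnds f r S).IsEulerian := by
  classical
  have hlink : ∀ e x y, (ofEnds f r S).IsLink e x y ↔ e ∈ S ∧ f e = s(x, y) :=
    fun _ _ _ => Iff.rfl
  refine ⟨⟨⟨r, .inl rfl⟩, ?_⟩, fun v _ => ?_⟩
  · set R : α → Prop := Relation.ReflTransGen (ofEnds f r S).Adj r with hR
    have hreach : ∀ v ∈ V(ofEnds f r S), R v := by
      rintro v (rfl | ⟨e, he, hv⟩)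
      · exact .refl
      · have hmem : ∀ e ∈ S, (f e, if σ e = -1 then 1 else 0) ∈ edgeMultiset f σ S :=
          fun e he => Multiset.mem_map.2 ⟨e, he, rfl⟩
        -- The vertices of `U` not reachable from `r` have an empty cut, so no edge ends there.
        have h0 := h.conn (U.filter fun x => ¬ R x)
          (fun hr => (Finset.mem_filter.1 hr).2 .refl) ?_ _ (hmem e he) v hv
        · by_contra hn
          exact h0 (Finset.mem_filter.2 ⟨hU e he v hv, hn⟩)
        · rw [cut_edgeMultiset, Finset.card_eq_zero, Finset.filter_eq_empty_iff]
          intro e he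
          have hUe := hU e he
          induction hfe : f e using Sym2.ind with | _ x y =>
          have hxy : R x ↔ R y :=
            ⟨fun h' => h'.tail ⟨e, he, hfe⟩, fun h' => h'.tail ⟨e, he, hfe.trans Sym2.eq_swap⟩⟩
          rw [hfe] at hUe
          simp [hUe x (by simp), hUe y (by simp), hxy]
    intro u hu v hv
    have hsymm : Relation.ReflTransGen (ofEnds f r S).Adj u r := by
      have : Std.Symm (ofEnds f r S).Adj := ⟨fun a b hab => (Graph.adj_comm a b).1 hab⟩
      exact Relation.ReflTransGen.stdSymm.symm _ _ (hreach u hu)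
    exact hsymm.trans (hreach v hv)
  · rw [deg_eq_degree σ hlink, ← cut_add_two_mul_count]
    exact (h.even {v}).add (even_two_mul _)

end SignedMultigraph

open SignedMultigraph

theorem theorem5p2 {α β : Type*} (G : Graph α β) (σ : β → ℤˣ)
    (hfin : G.IsFinite)
    (hconn : G.IsEdgeConnected 6)
    (hreg : G.IsRegular 6)
    (hodd : Odd (G.negEdges σ).ncard)
    (hcirc : ∃ C₁ C₂ : G.Trail, C₁.IsUnbalancedCircuit σ ∧ C₂.IsUnbalancedCircuit σ ∧
      Disjoint C₁.edges C₂.edges) :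
    G.HasRootedOddDecomposition σ 3 := by
  classical
  set W := hfin.vertexSet_finite.toFinset with hWdef
  set S := hfin.edgeSet_finite.toFinset with hSdef
  have hW : ∀ x, x ∈ W ↔ x ∈ V(G) := fun x => by simp [hWdef]
  have hS : ∀ e, e ∈ S ↔ e ∈ E(G) := fun e => by simp [hSdef]
  obtain ⟨f, hf⟩ := exists_ends G hconn.1.1
  simp only [← hS] at hf
  have hmem : ∀ e ∈ S, ∀ x ∈ f e, x ∈ W := by
    intro e he x hx
    obtain ⟨y, hy⟩ := Sym2.mem_iff_exists.1 hx
    exact (hW x).2 ((hf e x y).2 ⟨he, hy⟩).left_mem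
  have hdeg := deg_eq_degree σ hf
  have hdeg' : ∀ x, Even (degree x (edgeMultiset f σ S)) := by
    intro x
    by_cases hx : x ∈ V(G)
    · rw [← hdeg, hreg x hx]
      decide
    -- Evenness is required of cuts of all finite sets, including points outside the graph.
    · have h0 : degree x (edgeMultiset f σ S) = 0 := by
        refine Multiset.sum_eq_zero fun n hn => ?_
        obtain ⟨p, hp, rfl⟩ := Multiset.mem_map.1 hn
        obtain ⟨e, he, rfl⟩ := Multiset.mem_map.1 hp
        have hxe : x ∉ f e := fun hx' => hx ((hW x).1 (hmem e he x hx'))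
        rw [ends_eq, if_neg hxe, if_neg (fun h' : f e = s(x, x) => hxe (h' ▸ Sym2.mem_mk_left x x)), add_zero]
      rw [h0]
      exact Even.zero
  have hgood : IsGood W (edgeMultiset f σ S) := by
    refine ⟨fun p hp => ?_, even_cut_of_even_degree hdeg', fun x hx => ?_,
      sixCuts_of_isEdgeConnected σ hW hS hf hconn⟩
    · obtain ⟨e, he, rfl⟩ := Multiset.mem_map.1 hp
      exact hmem e he
    · rw [← hdeg, hreg x ((hW x).1 hx)]
  have hparity : parity (edgeMultiset f σ S) = 1 := by
    have : G.negEdges σ = ↑(S.filter fun e => σ e = -1) := by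
      ext e
      simp [Graph.negEdges, hS]
    rw [this, Set.ncard_coe_finset] at hodd
    rw [parity_edgeMultiset]
    exact ZMod.natCast_eq_one_iff_odd.2 hodd
  -- Under any switching, each of the two disjoint circuits keeps a negative edge of its own.
  have hab : ¬ IsAlmostBalanced (edgeMultiset f σ S) := by
    rintro ⟨X, hX⟩
    rw [negCount_switch_edgeMultiset, Finset.card_eq_one] at hX
    obtain ⟨e₀, he₀⟩ := hX
    obtain ⟨C₁, C₂, h1, h2, hdisj⟩ := hcirc
    obtain ⟨e₁, hm₁, hs₁, hn₁⟩ := exists_edge_of_isUnbalancedCircuit hf h1 X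
    obtain ⟨e₂, hm₂, hs₂, hn₂⟩ := exists_edge_of_isUnbalancedCircuit hf h2 X
    have q1 := Finset.mem_singleton.1 (he₀ ▸ Finset.mem_filter.2 ⟨hs₁, hn₁⟩)
    have q2 := Finset.mem_singleton.1 (he₀ ▸ Finset.mem_filter.2 ⟨hs₂, hn₂⟩)
    exact Set.disjoint_left.1 hdisj hm₁ (q1.trans q2.symm ▸ hm₂)
  have hWne : W.Nonempty := by
    obtain ⟨v, hv⟩ := hconn.1.1
    exact ⟨v, (hW v).2 hv⟩
  obtain ⟨r, hr, N, hN, hrooted⟩ := hasRootedPartition hgood hWne hparity hab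
  obtain ⟨P, hP, hPS, hPN⟩ := exists_partition_of_map_eq_sum _ hN
  have hrooted' : ∀ i, IsOddRooted r (edgeMultiset f σ (P i)) := fun i => by
    have := hPN i
    rw [← edgeMultiset] at this
    rw [this]
    exact hrooted i
  have hPS' : ∀ i, ∀ e ∈ P i, e ∈ S := fun i e he => (hPS e).2 ⟨i, he⟩
  refine ⟨fun i => ofEnds f r (P i), ⟨fun i => ⟨?_, ?_⟩, fun i j hij => ?_, ?_, fun i => ?_,
    fun i => ?_⟩, r, (hW r).1 hr, fun i => .inl rfl⟩
  · rintro x (rfl | ⟨e, he, hx⟩)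
    · exact (hW _).1 hr
    · exact (hW x).1 (hmem e (hPS' i e he) x hx)
  · intro e x y h
    exact (hf e x y).2 ⟨hPS' i e h.1, h.2⟩
  · exact Finset.disjoint_coe.2 (hP hij)
  · ext e
    rw [Set.mem_iUnion, ← hS, hPS]
    rfl
  · exact ofEnds_isEulerian (hrooted' i) fun e he => hmem e (hPS' i e he)
  · have h1 := (hrooted' i).parity_eq
    have : (ofEnds f r (P i)).negEdges σ = ↑((P i).filter fun e => σ e = -1) := by
      ext e
      simp [Graph.negEdges, ofEnds]
    rw [this, Set.ncard_coe_finset]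
    rw [parity_edgeMultiset] at h1
    exact ZMod.natCast_eq_one_iff_odd.1 h1
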